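/- Let $0<A<B<1$ and let $(\Omega,\mathcal P)$ be a probability space. Let $(a_n,b_n)_{n\ge1}$ be i.i.d. pairs of random variables with $A\le\min(a_n,b_n)$ and $a_n+b_n\le B$, and let $(p_n)_{n\ge 1}$ be i.i.d. random variables with values in $[0,1]$, independent of $(a_n,b_n)_{n\ge1}$, such that $\mathbb E(p_1^{-t})<\infty$ and $\mathbb E((1-p_1)^{-t})<\infty$ for some $t>0$. For $\omega\in\Omega$ construct the Moran intervals as follows: the only interval of step $0$ is $[0,1]$; an interval $I$ of step $n-1$ has two children of step $n$, namely the left-most closed subinterval of $I$ of length $a_n(\omega)|I|$ and the right-most closed subinterval of $I$ of length $b_n(\omega)|I|$. Let $\mu_\omega$ be the Borel probability measure on $[0,1]$ that gives the left child of each interval $I$ of step $n-1$ mass $p_n(\omega)\mu_\omega(I)$ and the right child mass $(1-p_n(\omega))\mu_\omega(I)$. A dimension function is a map $\Phi:(0,1)\to[0,\infty)$ such that $t^{1+\Phi(t)}$ decreases to $0$ as $t$ decreases to $0$. It is large if, for $t$ near $0$, $\Phi(t)=H(t)\,\log|\log t|/|\log t|$ with $H(t)\to\infty$ as $t\to0^+$.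 The upper $\Phi$-dimension $\overline{\dim}_\Phi\mu$ of a measure $\mu$ is the infimum of all real $d$ for which there are constants $C_1\in(0,1)$ and $C_2>0$ such that $$\frac{\mu(B(x,R))}{\mu(B(x,r))}\le C_2\Big(\frac Rr\Big)^d\qquad\text{for all }x\in\operatorname{supp}\mu\text{ and all }0<r<R^{1+\Phi(R)}\le R\le C_1 .$$ For $\theta\ge0$ put $(Y(\theta),Z(\theta))=(\log p_1,\log a_1)$ where $p_1\le \frac{a_1^\theta}{a_1^\theta+b_1^\theta}$, and $(Y(\theta),Z(\theta))=(\log(1-p_1),\log b_1)$ elsewhere, and let $G(\theta)=\mathbb E(Y(\theta))/\mathbb E(Z(\theta))$. Let $\Phi$ be a large dimension function. Then for every real $\alpha$, $\overline{\dim}_\Phi\mu_\omega=\alpha$ almost surely if and only if $G(\psi)<\psi$ for all $\psi\ge 0$ with $\psi>\alpha$, and $G(\psi)\ge\psi$ for all $\psi\ge0$ with $\psi<\alpha$. Moreover, there is always a real $\alpha\ge0$ with these two equivalent properties; that is, $\overline{\dim}_\Phi\mu_\omega$ has a finite almost sure value $\alpha$, and $G$ crosses the diagonal at $\alpha$. 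-/

import Mathlib

open MeasureTheory ProbabilityTheory Filter Topology

/-! ### Dimension functions and the upper `Φ`-dimension of a measure -/

/-- A dimension function: a map `Φ : (0,1) → [0,∞)` such that `t ^ (1 + Φ t)` decreases to `0` as `t`
decreases to `0`. Only the values of `Φ` on `(0,1)` matter. -/
structure IsDimensionFunction (Φ : ℝ → ℝ) : Prop where
  nonneg : ∀ t ∈ Set.Ioo (0 : ℝ) 1, 0 ≤ Φ t
  mono : MonotoneOn (fun t : ℝ => t ^ (1 + Φ t)) (Set.Ioo 0 1)
  tendsto_zero : Tendsto (fun t : ℝ => t ^ (1 + Φ t)) (𝓝[>] 0) (𝓝 0)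

/-- `Φ` is large: `Φ t = H t * log |log t| / |log t|` near `0`, where `H t → ∞` as `t → 0⁺`. -/
def IsLargeDimensionFunction (Φ : ℝ → ℝ) : Prop :=
  IsDimensionFunction Φ ∧
    ∃ H : ℝ → ℝ, Tendsto H (𝓝[>] 0) atTop ∧
      ∀ᶠ t in 𝓝[>] (0 : ℝ), Φ t = H t * (Real.log |Real.log t| / |Real.log t|)

/-- The exponents `d` that are admissible in the definition of the upper `Φ`-dimension of `μ`.
(Requiring `C₁ < 1` only keeps `R` in the domain `(0,1)` of `Φ`; shrinking `C₁` weakens the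
condition.) -/
def upperPhiExponents {X : Type*} [PseudoMetricSpace X] [MeasurableSpace X]
    (Φ : ℝ → ℝ) (μ : Measure X) : Set ℝ :=
  {d : ℝ | ∃ C₁ C₂ : ℝ, 0 < C₁ ∧ C₁ < 1 ∧ 0 < C₂ ∧
    ∀ r R : ℝ, 0 < r → r < R ^ (1 + Φ R) → R ^ (1 + Φ R) ≤ R → 0 < R → R ≤ C₁ →
      ∀ x ∈ μ.support,
        μ (Metric.ball x R) / μ (Metric.ball x r) ≤ ENNReal.ofReal (C₂ * (R / r) ^ d)}

/-- The upper `Φ`-dimension of a measure: the infimum of the admissible exponents, in `[-∞,∞]`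
(the infimum of the empty set is `∞`). -/
noncomputable def upperPhiDim {X : Type*} [PseudoMetricSpace X] [MeasurableSpace X]
    (Φ : ℝ → ℝ) (μ : Measure X) : EReal :=
  ⨅ d ∈ upperPhiExponents Φ μ, (d : EReal)

/-! ### The Moran construction in `[0,1]` with two children per interval

Levels are counted from `0`: `a n`, `b n`, `p n` are used to pass from step `n` to step `n + 1`.
An infinite word `v : ℕ → Bool` records the children chosen: `false` is the left child and `true`
is the right child. -/

/-- The length of the Moran interval of step `n` with label `v 0, …, v (n-1)`. -/
noncomputable def moranLength (a b : ℕ → ℝ) (v : ℕ → Bool) : ℕ → ℝ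
  | 0 => 1
  | n + 1 => (if v n then b n else a n) * moranLength a b v n

/-- The left end point of the Moran interval of step `n` with label `v 0, …, v (n-1)`. The left child
is the outer-most left subinterval, the right child is the outer-most right one. -/
noncomputable def moranLeft (a b : ℕ → ℝ) (v : ℕ → Bool) : ℕ → ℝ
  | 0 => 0
  | n + 1 => moranLeft a b v n + (if v n then (1 - b n) * moranLength a b v n else 0)

/-- The Moran interval of step `n` with label `v 0, …, v (n-1)`. -/
noncomputable def moranInterval (a b : ℕ → ℝ) (v : ℕ → Bool) (n : ℕ) : Set ℝ :=
  Set.Icc (moranLeft a b v n) (moranLeft a b v n + moranLength a b v n)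

/-- The point with address `v`, that is, the point common to all the intervals
`moranInterval a b v n`. -/
noncomputable def moranPoint (a b : ℕ → ℝ) (v : ℕ → Bool) : ℝ :=
  ⨆ n, moranLeft a b v n

/-- The Moran measure: the image, under the coding map `moranPoint a b`, of the product measure on
words under which the `n`-th letter is `false` (left) with probability `p n` and `true` (right) with
probability `1 - p n`. It is the probability measure that gives the left child of a step `n`
interval `I` the mass `p n * μ I` and the right child the mass `(1 - p n) * μ I`; see
`moranMeasure_moranInterval`. -/
noncomputable def moranMeasure (a b : ℕ → ℝ) (p : ℕ → unitInterval) : Measure ℝ :=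
  (Measure.infinitePi fun n => bernoulliMeasure false true (p n)).map (moranPoint a b)

section MoranFacts

variable {a b : ℕ → ℝ}

theorem moranLength_pos (ha : ∀ n, 0 < a n) (hb : ∀ n, 0 < b n) (v : ℕ → Bool) (n : ℕ) :
    0 < moranLength a b v n := by
  induction n with
  | zero => simp [moranLength]
  | succ n ih =>
    rw [moranLength]
    split_ifs
    · exact mul_pos (hb n) ih
    · exact mul_pos (ha n) ih

theorem moranInterval_congr {v w : ℕ → Bool} {n : ℕ} (h : ∀ i < n, v i = w i) :
    moranLength a b v n = moranLength a b w n ∧ moranLeft a b v n = moranLeft a b w n := by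
  induction n with
  | zero => simp [moranLength, moranLeft]
  | succ n ih =>
    obtain ⟨h1, h2⟩ := ih fun i hi => h i (by omega)
    simp only [moranLength, moranLeft, h1, h2, h n (by omega), and_self]

theorem moranInterval_succ_subset (ha : ∀ n, 0 < a n) (hb : ∀ n, 0 < b n)
    (hab : ∀ n, a n + b n < 1) (v : ℕ → Bool) (n : ℕ) :
    moranInterval a b v (n + 1) ⊆ moranInterval a b v n := by
  have hl := moranLength_pos ha hb v n
  have h1 := ha n
  have h2 := hb n
  have h3 := hab n
  apply Set.Icc_subset_Icc
  · simp only [moranLeft]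
    split_ifs
    · nlinarith
    · linarith
  · simp only [moranLeft, moranLength]
    split_ifs
    · nlinarith
    · nlinarith

theorem moranInterval_antitone (ha : ∀ n, 0 < a n) (hb : ∀ n, 0 < b n)
    (hab : ∀ n, a n + b n < 1) (v : ℕ → Bool) : Antitone (moranInterval a b v) :=
  antitone_nat_of_succ_le fun n => moranInterval_succ_subset ha hb hab v n

theorem moranPoint_mem (ha : ∀ n, 0 < a n) (hb : ∀ n, 0 < b n)
    (hab : ∀ n, a n + b n < 1) (v : ℕ → Bool) (n : ℕ) :
    moranPoint a b v ∈ moranInterval a b v n := by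
  have key : ∀ m k, moranLeft a b v m ≤ moranLeft a b v k + moranLength a b v k := by
    intro m k
    have hm : moranLeft a b v (max m k) ∈ moranInterval a b v (max m k) :=
      ⟨le_rfl, by linarith [moranLength_pos ha hb v (max m k)]⟩
    exact (moranInterval_antitone ha hb hab v (le_max_left m k) hm).1.trans
      (moranInterval_antitone ha hb hab v (le_max_right m k) hm).2
  exact ⟨le_ciSup (f := moranLeft a b v) ⟨_, by rintro _ ⟨m, rfl⟩; exact key m 0⟩ n,
    ciSup_le fun m => key m n⟩

theorem moranPoint_mem_iff (ha : ∀ n, 0 < a n) (hb : ∀ n, 0 < b n)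
    (hab : ∀ n, a n + b n < 1) (v w : ℕ → Bool) (n : ℕ) :
    moranPoint a b w ∈ moranInterval a b v n ↔ ∀ i < n, w i = v i := by
  constructor
  · intro h
    induction n with
    | zero => simp
    | succ n ih =>
      have hn := ih (moranInterval_succ_subset ha hb hab v n h)
      obtain ⟨e1, e2⟩ := moranInterval_congr (a := a) (b := b) hn
      have hw := moranPoint_mem ha hb hab w (n + 1)
      have hl := moranLength_pos ha hb v n
      have h3 := hab n
      have hlast : w n = v n := by
        simp only [moranInterval, moranLeft, moranLength, Set.mem_Icc, e1, e2] at h hw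
        cases hwn : w n <;> cases hvn : v n <;> simp [hwn, hvn] at h hw ⊢ <;> nlinarith
      intro i hi
      rcases Nat.lt_succ_iff_lt_or_eq.1 hi with hi | rfl
      · exact hn i hi
      · exact hlast
  · intro h
    obtain ⟨e1, e2⟩ := moranInterval_congr (a := a) (b := b) h
    have hw := moranPoint_mem ha hb hab w n
    rwa [moranInterval, e1, e2] at hw

theorem measurable_moranPoint : Measurable (moranPoint a b) := by
  have hlen : ∀ n, Measurable fun v => moranLength a b v n := by
    intro n
    induction n with
    | zero => simp [moranLength]
    | succ n ih =>
      simp only [moranLength]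
      exact ((measurable_of_countable fun c : Bool => if c then b n else a n).comp
        (measurable_pi_apply n)).mul ih
  have hleft : ∀ n, Measurable fun v => moranLeft a b v n := by
    intro n
    induction n with
    | zero => simp [moranLeft]
    | succ n ih =>
      simp only [moranLeft]
      refine ih.add (Measurable.ite ?_ ((hlen n).const_mul _) measurable_const)
      exact (measurable_pi_apply n : Measurable fun v : ℕ → Bool => v n)
        (measurableSet_singleton true)
  exact Measurable.iSup hleft

instance isProbabilityMeasure_moranMeasure (p : ℕ → unitInterval) :
    IsProbabilityMeasure (moranMeasure a b p) :=
  Measure.isProbabilityMeasure_map measurable_moranPoint.aemeasurable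

/-- The rule that determines the Moran measure. -/
theorem moranMeasure_moranInterval (ha : ∀ n, 0 < a n) (hb : ∀ n, 0 < b n)
    (hab : ∀ n, a n + b n < 1) (p : ℕ → unitInterval) (v : ℕ → Bool) (n : ℕ) :
    moranMeasure a b p (moranInterval a b v n) =
      ∏ i ∈ Finset.range n, ENNReal.ofReal (if v i then 1 - (p i : ℝ) else p i) := by
  rw [moranMeasure, Measure.map_apply measurable_moranPoint (by exact measurableSet_Icc)]
  have hpre : moranPoint a b ⁻¹' moranInterval a b v n =
      Set.pi (Finset.range n : Set ℕ) fun i => {v i} := by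
    ext w
    simp [moranPoint_mem_iff ha hb hab, Set.mem_pi]
  rw [hpre, Measure.infinitePi_pi _ fun i _ => measurableSet_singleton _]
  refine Finset.prod_congr rfl fun i _ => ?_
  have h0 : ENNReal.ofReal (p i : ℝ) = (unitInterval.toNNReal (p i) : ENNReal) :=
    ENNReal.ofReal_eq_coe_nnreal (p i).2.1
  have h1 : ENNReal.ofReal (1 - (p i : ℝ)) =
      (unitInterval.toNNReal (unitInterval.symm (p i)) : ENNReal) :=
    ENNReal.ofReal_eq_coe_nnreal (unitInterval.symm (p i)).2.1
  rw [bernoulliMeasure_def, Measure.add_apply, Measure.coe_nnreal_smul_apply,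
    Measure.coe_nnreal_smul_apply]
  cases v i <;> simp [h0, h1]

end MoranFacts

/-! ### The function `G` -/

/-- The weight `a ^ θ / (a ^ θ + b ^ θ)` against which the probability is compared. -/
noncomputable def moranThreshold (a b θ : ℝ) : ℝ := a ^ θ / (a ^ θ + b ^ θ)

/-- `Y(θ)` as a function of the values of `a`, `b`, `p`. -/
noncomputable def moranY (a b p θ : ℝ) : ℝ :=
  if p ≤ moranThreshold a b θ then Real.log p else Real.log (1 - p)

/-- `Z(θ)` as a function of the values of `a`, `b`, `p`. -/
noncomputable def moranZ (a b p θ : ℝ) : ℝ :=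
  if p ≤ moranThreshold a b θ then Real.log a else Real.log b

/-- `G(θ) = 𝔼 Y(θ) / 𝔼 Z(θ)`, for the random variables `a`, `b`, `p` of the first step. -/
noncomputable def moranG {Ω : Type*} [MeasurableSpace Ω] (P : Measure Ω)
    (a b : Ω → ℝ) (p : Ω → unitInterval) (θ : ℝ) : ℝ :=
  (∫ ω, moranY (a ω) (b ω) (p ω) θ ∂P) / (∫ ω, moranZ (a ω) (b ω) (p ω) θ ∂P)

/-- `G` crosses the diagonal at `α`: `G ψ < ψ` for all `ψ > α` and `G ψ ≥ ψ` for all `ψ < α`, where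
`ψ` ranges over the domain `[0,∞)` of `G`. -/
def CrossesDiagonalAt (G : ℝ → ℝ) (α : ℝ) : Prop :=
  (∀ ψ : ℝ, 0 ≤ ψ → α < ψ → G ψ < ψ) ∧ (∀ ψ : ℝ, 0 ≤ ψ → ψ < α → ψ ≤ G ψ)

/-!
Write `X θ` for the smaller of `log (weight) - θ log (ratio)` over the two children of an interval.
This is `Y θ - θ Z θ`, so, `𝔼 Z` being negative, `G θ < θ` if and only if `𝔼 (X θ) > 0`; moreover
`𝔼 (X θ)` increases strictly and continuously from a value `≤ 0` at `θ = 0` to `∞`, and its zero is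
the crossing point `α`.

The gap inside an interval is a fixed proportion of it at least, so balls centred in the support
compare with intervals. For an interval of step `n` inside one of step `m`, the ratio of the masses
is at most the `d`-th power of the ratio of the lengths as soon as `∑ X_i d ≥ 0` over `m ≤ i < n`.
* If `𝔼 (X d) > 0`, then by Chernoff's bound a block sum of length `k` is negative with probability
  at most `ρ ^ k`, so by Borel-Cantelli almost surely all block sums of large length `k` that start
  at a step `m ≤ L ^ k` are nonnegative, for some `L > 1`. As `Φ` is large, the scales
  `r < R ^ (1 + Φ R)` only involve such blocks, and `d` is admissible.
* If `𝔼 (X d) < 0`, follow the children that attain the minimum. By the law of large numbers, the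
  masses of these intervals are eventually smaller than any multiple of the `d`-th powers of their
  lengths, whereas an admissible `d` gives `μ (B(x, r)) ≥ c r ^ d`.
-/

/-! ### Geometry of the Moran intervals -/

/-- The ratio by which step `n` shrinks the interval labelled by the word `v`. -/
noncomputable def moranRatio (a b : ℕ → ℝ) (v : ℕ → Bool) (n : ℕ) : ℝ :=
  if v n then b n else a n

/-- The proportion of the mass that step `n` leaves to the interval labelled by the word `v`. -/
noncomputable def moranWeight (p : ℕ → unitInterval) (v : ℕ → Bool) (n : ℕ) : ℝ :=
  if v n then 1 - (p n : ℝ) else p n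

/-- The mass of the Moran interval of step `n` with label `v 0, …, v (n-1)`. -/
noncomputable def moranMass (p : ℕ → unitInterval) (v : ℕ → Bool) (n : ℕ) : ℝ :=
  ∏ i ∈ Finset.range n, moranWeight p v i

/-- The first step at which the Moran interval along the word `v` is shorter than `s`. If there is
no such step, then the value is `0`. -/
noncomputable def moranGeneration (a b : ℕ → ℝ) (v : ℕ → Bool) (s : ℝ) : ℕ :=
  sInf {n | moranLength a b v n < s}

/-- Ratios in the range allowed by the construction: they are at least `A > 0`, and the gap between
the two children of an interval is a proportion at least `1 - B > 0` of it. -/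
structure IsMoranRatios (A B : ℝ) (a b : ℕ → ℝ) : Prop where
  pos : 0 < A
  lt_one : B < 1
  le_left : ∀ n, A ≤ a n
  le_right : ∀ n, A ≤ b n
  add_le : ∀ n, a n + b n ≤ B

theorem le_moranLength_of_lt_moranGeneration {a b : ℕ → ℝ} {v : ℕ → Bool} {s : ℝ} {n : ℕ}
    (hn : n < moranGeneration a b v s) : s ≤ moranLength a b v n :=
  not_lt.1 (Nat.notMem_of_lt_sInf hn)

namespace IsMoranRatios

variable {A B : ℝ} {a b : ℕ → ℝ} (h : IsMoranRatios A B a b)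
include h

theorem left_pos (n : ℕ) : 0 < a n := h.pos.trans_le (h.le_left n)

theorem right_pos (n : ℕ) : 0 < b n := h.pos.trans_le (h.le_right n)

theorem add_lt_one (n : ℕ) : a n + b n < 1 := (h.add_le n).trans_lt h.lt_one

theorem ratio_mem_Icc (v : ℕ → Bool) (n : ℕ) : moranRatio a b v n ∈ Set.Icc A B := by
  have hadd := h.add_le n
  have ha := h.le_left n
  have hb := h.le_right n
  have hA := h.pos
  unfold moranRatio
  split_ifs <;> constructor <;> linarith

theorem ratio_pos (v : ℕ → Bool) (n : ℕ) : 0 < moranRatio a b v n :=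
  h.pos.trans_le (h.ratio_mem_Icc v n).1

theorem lower_le_upper : A ≤ B := by
  have hratio := h.ratio_mem_Icc (fun _ => false) 0
  exact hratio.1.trans hratio.2

theorem upper_pos : 0 < B := h.pos.trans_le h.lower_le_upper

theorem lower_lt_one : A < 1 := h.lower_le_upper.trans_lt h.lt_one

theorem one_sub_upper_pos : 0 < 1 - B := sub_pos.2 h.lt_one

theorem length_pos (v : ℕ → Bool) (n : ℕ) : 0 < moranLength a b v n :=
  moranLength_pos h.left_pos h.right_pos v n

theorem mul_length_le_length_succ (v : ℕ → Bool) (n : ℕ) :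
    A * moranLength a b v n ≤ moranLength a b v (n + 1) :=
  mul_le_mul_of_nonneg_right (h.ratio_mem_Icc v n).1 (h.length_pos v n).le

theorem length_succ_le_mul_length (v : ℕ → Bool) (n : ℕ) :
    moranLength a b v (n + 1) ≤ B * moranLength a b v n :=
  mul_le_mul_of_nonneg_right (h.ratio_mem_Icc v n).2 (h.length_pos v n).le

theorem antitone_length (v : ℕ → Bool) : Antitone (moranLength a b v) :=
  antitone_nat_of_succ_le fun n => (h.length_succ_le_mul_length v n).trans
    (mul_le_of_le_one_left (h.length_pos v n).le h.lt_one.le)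

theorem length_le_pow (v : ℕ → Bool) (n : ℕ) : moranLength a b v n ≤ B ^ n := by
  simpa [moranLength] using
    le_geom h.upper_pos.le n fun k _ => h.length_succ_le_mul_length v k

theorem pow_mul_length_le_length_add (v : ℕ → Bool) (m k : ℕ) :
    A ^ k * moranLength a b v m ≤ moranLength a b v (m + k) :=
  geom_le (u := fun k => moranLength a b v (m + k)) h.pos.le k
    fun i _ => h.mul_length_le_length_succ v (m + i)

theorem tendsto_length (v : ℕ → Bool) : Tendsto (moranLength a b v) atTop (𝓝 0) :=
  squeeze_zero (fun n => (h.length_pos v n).le) (h.length_le_pow v)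
    (tendsto_pow_atTop_nhds_zero_of_lt_one h.upper_pos.le h.lt_one)

theorem log_length (v : ℕ → Bool) (n : ℕ) :
    Real.log (moranLength a b v n) = ∑ i ∈ Finset.range n, Real.log (moranRatio a b v i) := by
  induction n with
  | zero => simp [moranLength]
  | succ n ih =>
    have hsucc : moranLength a b v (n + 1) = moranRatio a b v n * moranLength a b v n := rfl
    rw [hsucc, Real.log_mul (h.ratio_pos v n).ne' (h.length_pos v n).ne', ih,
      Finset.sum_range_succ, add_comm]

theorem length_generation_lt {s : ℝ} (hs : 0 < s) (v : ℕ → Bool) :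
    moranLength a b v (moranGeneration a b v s) < s :=
  Nat.sInf_mem (s := {n | moranLength a b v n < s})
    ((h.tendsto_length v).eventually_lt_const hs).exists

theorem generation_anti {r s : ℝ} (hr : 0 < r) (hrs : r ≤ s) (v : ℕ → Bool) :
    moranGeneration a b v s ≤ moranGeneration a b v r :=
  Nat.sInf_le ((h.length_generation_lt hr v).trans_le hrs)

theorem mul_le_length_generation {R s : ℝ} (hR : R ≤ 1) (hRs : R ≤ s) (v : ℕ → Bool) :
    A * R ≤ moranLength a b v (moranGeneration a b v s) := by
  rcases hn : moranGeneration a b v s with _ | n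
  · exact (mul_le_of_le_one_right h.pos.le hR).trans h.lower_lt_one.le
  · have hs : s ≤ moranLength a b v n := le_moranLength_of_lt_moranGeneration (by omega)
    exact (mul_le_mul_of_nonneg_left (hRs.trans hs) h.pos.le).trans
      (h.mul_length_le_length_succ v n)

theorem moranPoint_mem_interval (v : ℕ → Bool) (n : ℕ) :
    moranPoint a b v ∈ moranInterval a b v n :=
  moranPoint_mem h.left_pos h.right_pos h.add_lt_one v n

theorem moranPoint_mem_interval_iff (v w : ℕ → Bool) (n : ℕ) :
    moranPoint a b w ∈ moranInterval a b v n ↔ ∀ i < n, w i = v i :=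
  moranPoint_mem_iff h.left_pos h.right_pos h.add_lt_one v w n

theorem interval_subset_ball {v : ℕ → Bool} {n : ℕ} {r : ℝ} (hr : moranLength a b v n < r) :
    moranInterval a b v n ⊆ Metric.ball (moranPoint a b v) r := by
  intro y hy
  refine (Real.dist_le_of_mem_Icc hy (h.moranPoint_mem_interval v n)).trans_lt ?_
  rwa [add_sub_cancel_left]

theorem gap_le_dist {v w : ℕ → Bool} {n : ℕ} (hvw : ∀ i < n, w i = v i) (hn : w n ≠ v n) :
    (1 - B) * moranLength a b v n ≤ dist (moranPoint a b w) (moranPoint a b v) := by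
  have hv := h.moranPoint_mem_interval v (n + 1)
  have hw := h.moranPoint_mem_interval w (n + 1)
  obtain ⟨hlen, hleft⟩ := moranInterval_congr (a := a) (b := b) hvw
  have hpos := h.length_pos v n
  have hadd := h.add_le n
  simp only [moranInterval, moranLeft, moranLength, Set.mem_Icc, hlen, hleft] at hv hw
  rw [Real.dist_eq, le_abs]
  cases hwn : w n <;> cases hvn : v n <;>
    simp only [hwn, hvn, Bool.false_eq_true, Bool.true_eq_false, ↓reduceIte, add_zero, ne_eq,
      not_true_eq_false, not_false_eq_true] at hv hw hn
  · right; nlinarith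
  · left; nlinarith

theorem eq_of_dist_lt_gap {v w : ℕ → Bool} {n : ℕ}
    (hlt : dist (moranPoint a b w) (moranPoint a b v) < (1 - B) * moranLength a b v n) :
    ∀ i ≤ n, w i = v i := by
  intro i
  induction i using Nat.strong_induction_on with
  | _ i ih =>
    intro hi
    by_contra hne
    have hgap := h.gap_le_dist (fun j hj => ih j hj (by omega)) hne
    have hlen := mul_le_mul_of_nonneg_left (h.antitone_length v hi) h.one_sub_upper_pos.le
    linarith

theorem continuous_moranPoint : Continuous (moranPoint a b) := by
  refine continuous_iff_continuousAt.2 fun v => Metric.tendsto_nhds.2 fun ε hε => ?_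
  obtain ⟨n, hn⟩ := ((h.tendsto_length v).eventually_lt_const hε).exists
  have hagree : ∀ᶠ w in 𝓝 v, ∀ i ∈ Finset.range n, w i = v i := by
    refine (Finset.eventually_all _).2 fun i _ => ?_
    exact (continuous_apply i).continuousAt.eventually_mem
      ((isOpen_discrete {v i}).mem_nhds rfl)
  filter_upwards [hagree] with w hw
  exact h.interval_subset_ball hn
    ((h.moranPoint_mem_interval_iff v w n).2 fun i hi => hw i (Finset.mem_range.2 hi))

end IsMoranRatios

/-! ### Masses of intervals and of balls -/

section Mass

variable {p : ℕ → unitInterval}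

theorem moranWeight_nonneg (p : ℕ → unitInterval) (v : ℕ → Bool) (n : ℕ) :
    0 ≤ moranWeight p v n := by
  unfold moranWeight
  split_ifs
  exacts [sub_nonneg.2 (p n).2.2, (p n).2.1]

theorem moranWeight_pos (hp : ∀ n, (p n : ℝ) ∈ Set.Ioo 0 1) (v : ℕ → Bool) (n : ℕ) :
    0 < moranWeight p v n := by
  unfold moranWeight
  split_ifs
  exacts [sub_pos.2 (hp n).2, (hp n).1]

theorem moranMass_pos (hp : ∀ n, (p n : ℝ) ∈ Set.Ioo 0 1) (v : ℕ → Bool) (n : ℕ) :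
    0 < moranMass p v n :=
  Finset.prod_pos fun i _ => moranWeight_pos hp v i

theorem log_moranMass (hp : ∀ n, (p n : ℝ) ∈ Set.Ioo 0 1) (v : ℕ → Bool) (n : ℕ) :
    Real.log (moranMass p v n) = ∑ i ∈ Finset.range n, Real.log (moranWeight p v i) :=
  Real.log_prod fun i _ => (moranWeight_pos hp v i).ne'

end Mass

namespace IsMoranRatios

variable {A B : ℝ} {a b : ℕ → ℝ} {p : ℕ → unitInterval} (h : IsMoranRatios A B a b)
include h

theorem measure_interval (p : ℕ → unitInterval) (v : ℕ → Bool) (n : ℕ) :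
    moranMeasure a b p (moranInterval a b v n) = ENNReal.ofReal (moranMass p v n) := by
  rw [moranMeasure_moranInterval h.left_pos h.right_pos h.add_lt_one, moranMass,
    ENNReal.ofReal_prod_of_nonneg fun i _ => moranWeight_nonneg p v i]
  rfl

theorem mass_le_measure_ball {v : ℕ → Bool} {n : ℕ} {r : ℝ} (hr : moranLength a b v n < r) :
    ENNReal.ofReal (moranMass p v n) ≤ moranMeasure a b p (Metric.ball (moranPoint a b v) r) :=
  h.measure_interval p v n ▸ measure_mono (h.interval_subset_ball hr)

theorem measure_ball_le_mass {v : ℕ → Bool} {n : ℕ} {R : ℝ}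
    (hR : ∀ i < n, R ≤ (1 - B) * moranLength a b v i) :
    moranMeasure a b p (Metric.ball (moranPoint a b v) R) ≤ ENNReal.ofReal (moranMass p v n) := by
  rw [← h.measure_interval p v n, moranMeasure,
    Measure.map_apply measurable_moranPoint measurableSet_ball,
    Measure.map_apply measurable_moranPoint (by exact measurableSet_Icc)]
  refine measure_mono fun w hw => ?_
  rw [Set.mem_preimage, h.moranPoint_mem_interval_iff]
  exact fun i hi => h.eq_of_dist_lt_gap (lt_of_lt_of_le hw (hR i hi)) i le_rfl

theorem support_moranMeasure (hp : ∀ n, (p n : ℝ) ∈ Set.Ioo 0 1) :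
    (moranMeasure a b p).support = Set.range (moranPoint a b) := by
  apply Set.Subset.antisymm
  · have hclosed : IsClosed (Set.range (moranPoint a b)) :=
      (isCompact_range h.continuous_moranPoint).isClosed
    refine Measure.support_subset_of_isClosed hclosed ?_
    exact (ae_map_mem_range _ hclosed.measurableSet _)
  · rintro _ ⟨v, rfl⟩
    refine (Measure.mem_support_iff_forall _).2 fun U hU => ?_
    obtain ⟨ε, hε, hsub⟩ := Metric.mem_nhds_iff.1 hU
    calc 0 < ENNReal.ofReal (moranMass p v (moranGeneration a b v ε)) :=
          ENNReal.ofReal_pos.2 (moranMass_pos hp v _)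
      _ ≤ moranMeasure a b p (Metric.ball (moranPoint a b v) ε) :=
          h.mass_le_measure_ball (h.length_generation_lt hε v)
      _ ≤ moranMeasure a b p U := measure_mono hsub

end IsMoranRatios

/-! ### Admissible exponents -/

section UpperPhiExponents

variable {X : Type*} [PseudoMetricSpace X] [MeasurableSpace X] {Φ : ℝ → ℝ} {μ : Measure X}

theorem mem_upperPhiExponents_of_eventually {C d : ℝ} (hC : 0 < C)
    (hbound : ∀ᶠ R in 𝓝[>] (0 : ℝ), ∀ r, 0 < r → r < R ^ (1 + Φ R) → R ^ (1 + Φ R) ≤ R →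
      ∀ x ∈ μ.support,
        μ (Metric.ball x R) / μ (Metric.ball x r) ≤ ENNReal.ofReal (C * (R / r) ^ d)) :
    d ∈ upperPhiExponents Φ μ := by
  obtain ⟨ε, hε, hsub⟩ := mem_nhdsGT_iff_exists_Ioc_subset.1 hbound
  have hε : 0 < ε := hε
  refine ⟨min ε (1 / 2), C, by positivity, (min_le_right _ _).trans_lt (by norm_num), hC, ?_⟩
  exact fun r R hr hrR hRR hR hRε => hsub ⟨hR, hRε.trans (min_le_left _ _)⟩ r hr hrR hRR

theorem isUpperSet_upperPhiExponents : IsUpperSet (upperPhiExponents Φ μ) := by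
  rintro d e hde ⟨C₁, C₂, hC₁, hC₁_lt, hC₂, hbound⟩
  refine ⟨C₁, C₂, hC₁, hC₁_lt, hC₂, fun r R hr hrR hRR hR hRC x hx => ?_⟩
  refine (hbound r R hr hrR hRR hR hRC x hx).trans (ENNReal.ofReal_le_ofReal ?_)
  have hone : 1 ≤ R / r := (one_le_div hr).2 (hrR.le.trans hRR)
  gcongr

theorem upperPhiDim_eq_of_forall_rat {α : ℝ}
    (hlt : ∀ q : ℚ, (q : ℝ) < α → (q : ℝ) ∉ upperPhiExponents Φ μ)
    (hgt : ∀ q : ℚ, α < (q : ℝ) → (q : ℝ) ∈ upperPhiExponents Φ μ) :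
    upperPhiDim Φ μ = (α : EReal) := by
  apply le_antisymm
  · refine EReal.le_of_forall_lt_iff_le.1 fun z hz => ?_
    obtain ⟨q, hαq, hqz⟩ := exists_rat_btwn (EReal.coe_lt_coe_iff.1 hz)
    exact (iInf₂_le (q : ℝ) (hgt q hαq)).trans (EReal.coe_le_coe_iff.2 hqz.le)
  · refine le_iInf₂ fun d hd => EReal.coe_le_coe_iff.2 (not_lt.1 fun hdα => ?_)
    obtain ⟨q, hdq, hqα⟩ := exists_rat_btwn hdα
    exact hlt q hqα (isUpperSet_upperPhiExponents hdq.le hd)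

theorem exists_mul_rpow_le_measure_ball {d : ℝ} (hd : d ∈ upperPhiExponents Φ μ)
    (hΦ : ∀ t ∈ Set.Ioo (0 : ℝ) 1, 0 ≤ Φ t) {x : X} (hx : x ∈ μ.support) :
    ∃ c : ℝ, 0 < c ∧ ∀ᶠ r in 𝓝[>] (0 : ℝ), ENNReal.ofReal (c * r ^ d) ≤ μ (Metric.ball x r) := by
  obtain ⟨R, C, hR, hR_lt, hC, hbound⟩ := hd
  have hpos : ∀ r > 0, 0 < μ (Metric.ball x r) := fun r hr =>
    (Measure.mem_support_iff_forall x).1 hx _ (Metric.ball_mem_nhds x hr)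
  obtain ⟨ε, hε, hεR⟩ := ENNReal.lt_iff_exists_nnreal_btwn.1 (hpos R hR)
  have hε : 0 < (ε : ℝ) := by exact_mod_cast hε
  have hRR : R ^ (1 + Φ R) ≤ R := by
    simpa only [Real.rpow_one] using Real.rpow_le_rpow_of_exponent_ge hR hR_lt.le
      (le_add_of_nonneg_right (hΦ R ⟨hR, hR_lt⟩) : 1 ≤ 1 + Φ R)
  refine ⟨ε / (C * R ^ d), by positivity, ?_⟩
  filter_upwards [Ioo_mem_nhdsGT (Real.rpow_pos_of_pos hR (1 + Φ R))] with r ⟨hr, hrR⟩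
  have hK : 0 < C * (R / r) ^ d := by have := div_pos hR hr; positivity
  have hdiv := hbound r R hr hrR hRR hR le_rfl x hx
  rw [ENNReal.div_le_iff_le_mul (Or.inl (hpos r hr).ne')
    (Or.inr (ENNReal.ofReal_pos.2 hK).ne')] at hdiv
  calc ENNReal.ofReal (ε / (C * R ^ d) * r ^ d)
      = ENNReal.ofReal ε / ENNReal.ofReal (C * (R / r) ^ d) := by
        rw [← ENNReal.ofReal_div_of_pos hK, Real.div_rpow hR.le hr.le]
        congr 1
        field_simp
    _ ≤ μ (Metric.ball x r) :=
        ENNReal.div_le_of_le_mul' (by simpa using hεR.le.trans hdiv)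

end UpperPhiExponents

/-! ### Scales of a large dimension function -/

theorem tendsto_abs_log_nhdsGT_zero : Tendsto (fun R : ℝ => |Real.log R|) (𝓝[>] 0) atTop :=
  tendsto_abs_atBot_atTop.comp Real.tendsto_log_nhdsGT_zero

theorem eventually_natCast_le_sq_abs_log {A B : ℝ} (hA : 0 < A) (hB : 0 < B) (hB_lt : B < 1) :
    ∀ᶠ R in 𝓝[>] (0 : ℝ), ∀ m : ℕ, A * R ≤ B ^ m → (m : ℝ) ≤ |Real.log R| ^ 2 := by
  have hlogB : 0 < -Real.log B := neg_pos.2 (Real.log_neg hB hB_lt)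
  filter_upwards [tendsto_abs_log_nhdsGT_zero.eventually_ge_atTop (-Real.log A),
    tendsto_abs_log_nhdsGT_zero.eventually_ge_atTop (2 / -Real.log B),
    Ioo_mem_nhdsGT one_pos] with R hRA hRB ⟨hR, hR_lt⟩ m hm
  have hlog := Real.log_le_log (by positivity) hm
  rw [Real.log_mul hA.ne' hR.ne', Real.log_pow] at hlog
  have habs : |Real.log R| = -Real.log R := abs_of_neg (Real.log_neg hR hR_lt)
  have hm_le : (m : ℝ) * -Real.log B ≤ 2 * |Real.log R| := by linarith
  calc (m : ℝ) ≤ 2 * |Real.log R| / -Real.log B := (le_div_iff₀ hlogB).2 hm_le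
    _ = 2 / -Real.log B * |Real.log R| := by ring
    _ ≤ |Real.log R| * |Real.log R| := by gcongr
    _ = |Real.log R| ^ 2 := (sq _).symm

namespace IsLargeDimensionFunction

variable {Φ : ℝ → ℝ} (hΦ : IsLargeDimensionFunction Φ)
include hΦ

theorem eventually_mul_log_abs_log_le (K : ℝ) :
    ∀ᶠ R in 𝓝[>] (0 : ℝ), K * Real.log |Real.log R| ≤ Φ R * |Real.log R| := by
  obtain ⟨-, H, hH, hΦH⟩ := hΦ
  filter_upwards [hΦH, hH.eventually_ge_atTop K,
    tendsto_abs_log_nhdsGT_zero.eventually_gt_atTop 1] with R hΦR hKH hlog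
  rw [hΦR, mul_assoc, div_mul_cancel₀ _ (by linarith)]
  exact mul_le_mul_of_nonneg_right hKH (Real.log_nonneg hlog.le)

theorem eventually_sq_abs_log_le_pow {A L : ℝ} (hA : 0 < A) (hA_lt : A < 1) (hL : 1 < L) :
    ∀ᶠ R in 𝓝[>] (0 : ℝ), ∀ k : ℕ, A ^ (k + 1) < R ^ Φ R → |Real.log R| ^ 2 ≤ L ^ k := by
  have hlogA : 0 < -Real.log A := neg_pos.2 (Real.log_neg hA hA_lt)
  have hlogL : 0 < Real.log L := Real.log_pos hL
  filter_upwards [hΦ.eventually_mul_log_abs_log_le (-Real.log A * (2 / Real.log L + 1)),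
    tendsto_abs_log_nhdsGT_zero.eventually_ge_atTop (Real.exp 1),
    Ioo_mem_nhdsGT one_pos] with R hK hexp ⟨hR, hR_lt⟩ k hk
  have hpos : 0 < |Real.log R| := (Real.exp_pos 1).trans_le hexp
  have hloglog : 1 ≤ Real.log |Real.log R| := (Real.le_log_iff_exp_le hpos).2 hexp
  have habs : |Real.log R| = -Real.log R := abs_of_neg (Real.log_neg hR hR_lt)
  have hlt : Φ R * |Real.log R| < -Real.log A * (k + 1) := by
    have hlog := Real.log_lt_log (by positivity) hk
    rw [Real.log_pow, Real.log_rpow hR] at hlog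
    push_cast at hlog
    rw [habs]
    linarith
  have hk_ge : (2 / Real.log L + 1) * Real.log |Real.log R| ≤ k + 1 := by
    refine le_of_mul_le_mul_left ?_ hlogA
    linarith
  have hk_log : Real.log |Real.log R| * 2 ≤ k * Real.log L := by
    rw [← div_le_iff₀ hlogL]
    calc Real.log |Real.log R| * 2 / Real.log L
        = 2 / Real.log L * Real.log |Real.log R| := by ring
      _ ≤ k := by linarith
  refine (Real.log_le_log_iff (by positivity) (by positivity)).1 ?_
  rw [Real.log_pow, Real.log_pow]
  push_cast
  linarith

theorem eventually_le_and_natCast_le_pow {A B L : ℝ} (hA : 0 < A) (hA_lt : A < 1) (hB : 0 < B)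
    (hB_lt : B < 1) (hL : 1 < L) (k₀ : ℕ) :
    ∀ᶠ R in 𝓝[>] (0 : ℝ), ∀ m k : ℕ, A * R ≤ B ^ m → A ^ (k + 1) < R ^ Φ R →
      k₀ ≤ k ∧ (m : ℝ) ≤ L ^ k := by
  have hsq : Tendsto (fun R : ℝ => |Real.log R| ^ 2) (𝓝[>] 0) atTop :=
    (tendsto_pow_atTop two_ne_zero).comp tendsto_abs_log_nhdsGT_zero
  filter_upwards [eventually_natCast_le_sq_abs_log hA hB hB_lt,
    hΦ.eventually_sq_abs_log_le_pow hA hA_lt hL, hsq.eventually_ge_atTop (L ^ k₀)]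
    with R hm hk hk₀ m k hmR hkR
  exact ⟨(pow_le_pow_iff_right₀ hL).1 (hk₀.trans (hk k hkR)), (hm m hmR).trans (hk k hkR)⟩

end IsLargeDimensionFunction

/-! ### The excess of mass over length -/

/-- The smaller of the two values of `log (weight) - θ * log (ratio)` over the children of an
interval: a word gains at least this much of `log (mass) - θ * log (length)` at each step. It equals
`moranY - θ * moranZ`, see `moranY_sub_mul_moranZ`. -/
noncomputable def moranExcess (a b p θ : ℝ) : ℝ :=
  min (Real.log p - θ * Real.log a) (Real.log (1 - p) - θ * Real.log b)

theorem moranExcess_le (a b : ℕ → ℝ) (p : ℕ → unitInterval) (θ : ℝ) (v : ℕ → Bool) (i : ℕ) :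
    moranExcess (a i) (b i) (p i) θ ≤
      Real.log (moranWeight p v i) - θ * Real.log (moranRatio a b v i) := by
  unfold moranExcess moranWeight moranRatio
  split_ifs
  exacts [min_le_right _ _, min_le_left _ _]

theorem exists_forall_moranExcess_eq (a b : ℕ → ℝ) (p : ℕ → unitInterval) (θ : ℝ) :
    ∃ v : ℕ → Bool, ∀ i, moranExcess (a i) (b i) (p i) θ =
      Real.log (moranWeight p v i) - θ * Real.log (moranRatio a b v i) := by
  have hletter : ∀ i, ∃ c : Bool, moranExcess (a i) (b i) (p i) θ =
      Real.log (if c then 1 - (p i : ℝ) else p i) - θ * Real.log (if c then b i else a i) := by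
    intro i
    rcases min_choice (Real.log (p i) - θ * Real.log (a i))
      (Real.log (1 - p i) - θ * Real.log (b i)) with hmin | hmin
    exacts [⟨false, hmin⟩, ⟨true, hmin⟩]
  choose v hv using hletter
  exact ⟨v, hv⟩

namespace IsMoranRatios

variable {A B : ℝ} {a b : ℕ → ℝ} {p : ℕ → unitInterval} (h : IsMoranRatios A B a b)
include h

theorem sum_moranExcess_Ico_le (hp : ∀ n, (p n : ℝ) ∈ Set.Ioo 0 1) (θ : ℝ) (v : ℕ → Bool)
    {m n : ℕ} (hmn : m ≤ n) :
    ∑ i ∈ Finset.Ico m n, moranExcess (a i) (b i) (p i) θ ≤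
      (Real.log (moranMass p v n) - Real.log (moranMass p v m)) -
        θ * (Real.log (moranLength a b v n) - Real.log (moranLength a b v m)) := by
  rw [log_moranMass hp, log_moranMass hp, h.log_length, h.log_length,
    ← Finset.sum_Ico_eq_sub _ hmn, ← Finset.sum_Ico_eq_sub _ hmn, Finset.mul_sum,
    ← Finset.sum_sub_distrib]
  exact Finset.sum_le_sum fun i _ => moranExcess_le a b p θ v i

theorem exists_forall_sum_moranExcess_eq (hp : ∀ n, (p n : ℝ) ∈ Set.Ioo 0 1) (θ : ℝ) :
    ∃ v : ℕ → Bool, ∀ n, ∑ i ∈ Finset.range n, moranExcess (a i) (b i) (p i) θ =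
      Real.log (moranMass p v n) - θ * Real.log (moranLength a b v n) := by
  obtain ⟨v, hv⟩ := exists_forall_moranExcess_eq a b p θ
  refine ⟨v, fun n => ?_⟩
  rw [log_moranMass hp, h.log_length, Finset.mul_sum, ← Finset.sum_sub_distrib]
  exact Finset.sum_congr rfl fun i _ => hv i

theorem mass_div_mass_le_rpow (hp : ∀ n, (p n : ℝ) ∈ Set.Ioo 0 1) {d : ℝ} (v : ℕ → Bool)
    {m n : ℕ} (hmn : m ≤ n)
    (hsum : 0 ≤ ∑ i ∈ Finset.Ico m n, moranExcess (a i) (b i) (p i) d) :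
    moranMass p v m / moranMass p v n ≤ (moranLength a b v m / moranLength a b v n) ^ d := by
  have hMm := moranMass_pos hp v m
  have hMn := moranMass_pos hp v n
  have hlm := h.length_pos v m
  have hln := h.length_pos v n
  have hle := hsum.trans (h.sum_moranExcess_Ico_le hp d v hmn)
  rw [← Real.log_le_log_iff (by positivity) (by positivity), Real.log_rpow (by positivity),
    Real.log_div hMm.ne' hMn.ne', Real.log_div hlm.ne' hln.ne']
  linarith

theorem length_div_length_generation_le {r s : ℝ} (hr : 0 < r) (hr_le : r ≤ 1) (hs : 0 < s)
    (v : ℕ → Bool) :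
    moranLength a b v (moranGeneration a b v s) / moranLength a b v (moranGeneration a b v r) ≤
      s / (A * r) :=
  div_le_div₀ hs.le (h.length_generation_lt hs v).le (mul_pos h.pos hr)
    (h.mul_le_length_generation hr_le le_rfl v)

theorem le_div_one_sub_upper {R : ℝ} (hR : 0 ≤ R) : R ≤ R / (1 - B) :=
  le_div_self hR h.one_sub_upper_pos (by linarith [h.upper_pos])

theorem measure_ball_div_measure_ball_le (hp : ∀ n, (p n : ℝ) ∈ Set.Ioo 0 1) {d r R : ℝ}
    (hd : 0 ≤ d) (hr : 0 < r) (hrR : r ≤ R) (hR : R ≤ 1) (v : ℕ → Bool)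
    (hsum : 0 ≤ ∑ i ∈ Finset.Ico (moranGeneration a b v (R / (1 - B))) (moranGeneration a b v r),
      moranExcess (a i) (b i) (p i) d) :
    moranMeasure a b p (Metric.ball (moranPoint a b v) R) /
        moranMeasure a b p (Metric.ball (moranPoint a b v) r) ≤
      ENNReal.ofReal ((1 / ((1 - B) * A)) ^ d * (R / r) ^ d) := by
  have hR_pos := hr.trans_le hrR
  have hA := h.pos
  have hgap := h.one_sub_upper_pos
  set m := moranGeneration a b v (R / (1 - B))
  set n := moranGeneration a b v r
  have hmn : m ≤ n := h.generation_anti hr (hrR.trans (h.le_div_one_sub_upper hR_pos.le)) v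
  -- a ball of radius `R` does not reach across the gap of an interval of length `≥ R / (1 - B)`
  have hball : moranMeasure a b p (Metric.ball (moranPoint a b v) R) ≤
      ENNReal.ofReal (moranMass p v m) :=
    h.measure_ball_le_mass fun i hi =>
      (div_le_iff₀' hgap).1 (le_moranLength_of_lt_moranGeneration hi)
  calc moranMeasure a b p (Metric.ball (moranPoint a b v) R) /
        moranMeasure a b p (Metric.ball (moranPoint a b v) r)
      ≤ ENNReal.ofReal (moranMass p v m) / ENNReal.ofReal (moranMass p v n) :=
        ENNReal.div_le_div hball (h.mass_le_measure_ball (h.length_generation_lt hr v))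
    _ = ENNReal.ofReal (moranMass p v m / moranMass p v n) :=
        (ENNReal.ofReal_div_of_pos (moranMass_pos hp v n)).symm
    _ ≤ ENNReal.ofReal ((1 / ((1 - B) * A)) ^ d * (R / r) ^ d) := by
        refine ENNReal.ofReal_le_ofReal ((h.mass_div_mass_le_rpow hp v hmn hsum).trans ?_)
        rw [← Real.mul_rpow (by positivity) (by positivity)]
        refine Real.rpow_le_rpow (div_pos (h.length_pos v m) (h.length_pos v n)).le ?_ hd
        refine (h.length_div_length_generation_le hr (hrR.trans hR) (by positivity) v).trans_eq ?_
        field_simp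

theorem pow_sub_add_one_lt_rpow {R φ : ℝ} (hR : 0 < R) (v : ℕ → Bool) {m n : ℕ} (hmn : m ≤ n)
    (hm : A * R ≤ moranLength a b v m) (hn : moranLength a b v n < R ^ (1 + φ)) :
    A ^ (n - m + 1) < R ^ φ := by
  have hlen := h.pow_mul_length_le_length_add v m (n - m)
  rw [Nat.add_sub_cancel' hmn] at hlen
  refine lt_of_mul_lt_mul_right ?_ hR.le
  calc A ^ (n - m + 1) * R = A ^ (n - m) * (A * R) := by ring
    _ ≤ A ^ (n - m) * moranLength a b v m := mul_le_mul_of_nonneg_left hm (pow_nonneg h.pos.le _)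
    _ < R ^ (1 + φ) := hlen.trans_lt hn
    _ = R ^ φ * R := by rw [Real.rpow_add hR, Real.rpow_one, mul_comm]

theorem mem_upperPhiExponents (hp : ∀ n, (p n : ℝ) ∈ Set.Ioo 0 1) {Φ : ℝ → ℝ}
    (hΦ : IsLargeDimensionFunction Φ) {d L : ℝ} (hd : 0 ≤ d) (hL : 1 < L)
    (hsum : ∀ᶠ k : ℕ in atTop, ∀ m : ℕ, (m : ℝ) ≤ L ^ k →
      0 ≤ ∑ i ∈ Finset.Ico m (m + k), moranExcess (a i) (b i) (p i) d) :
    d ∈ upperPhiExponents Φ (moranMeasure a b p) := by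
  obtain ⟨k₀, hk₀⟩ := eventually_atTop.1 hsum
  have hC : 0 < (1 / ((1 - B) * A)) ^ d :=
    Real.rpow_pos_of_pos (one_div_pos.2 (mul_pos h.one_sub_upper_pos h.pos)) d
  refine mem_upperPhiExponents_of_eventually hC ?_
  filter_upwards [hΦ.eventually_le_and_natCast_le_pow h.pos h.lower_lt_one h.upper_pos h.lt_one
    hL k₀, Ioc_mem_nhdsGT one_pos] with R hscale ⟨hR, hR_le⟩ r hr hrR hRR x hx
  rw [h.support_moranMeasure hp] at hx
  obtain ⟨v, rfl⟩ := hx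
  have hrR_le := hrR.le.trans hRR
  have hRB := h.le_div_one_sub_upper hR.le
  have hmn := h.generation_anti hr (hrR_le.trans hRB) v
  have hm_ge := h.mul_le_length_generation hR_le hRB v
  obtain ⟨hk, hm⟩ := hscale _ _ (hm_ge.trans (h.length_le_pow v _))
    (h.pow_sub_add_one_lt_rpow hR v hmn hm_ge ((h.length_generation_lt hr v).trans hrR))
  have hblock := hk₀ _ hk _ hm
  rw [Nat.add_sub_cancel' hmn] at hblock
  exact h.measure_ball_div_measure_ball_le hp hd hr hrR_le hR_le v hblock

theorem notMem_upperPhiExponents (hp : ∀ n, (p n : ℝ) ∈ Set.Ioo 0 1) {Φ : ℝ → ℝ}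
    (hΦ : ∀ t ∈ Set.Ioo (0 : ℝ) 1, 0 ≤ Φ t) {d : ℝ}
    (hsum : Tendsto (fun n => ∑ i ∈ Finset.range n, moranExcess (a i) (b i) (p i) d) atTop atBot) :
    d ∉ upperPhiExponents Φ (moranMeasure a b p) := by
  intro hd
  have hgap := h.one_sub_upper_pos
  obtain ⟨v, hv⟩ := h.exists_forall_sum_moranExcess_eq hp d
  have hx : moranPoint a b v ∈ (moranMeasure a b p).support :=
    h.support_moranMeasure hp ▸ Set.mem_range_self v
  obtain ⟨c, hc, hball⟩ := exists_mul_rpow_le_measure_ball hd hΦ hx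
  have hradius : Tendsto (fun n => (1 - B) * moranLength a b v n) atTop (𝓝[>] 0) := by
    refine tendsto_nhdsWithin_iff.2 ⟨?_, .of_forall fun n => mul_pos hgap (h.length_pos v n)⟩
    simpa only [mul_zero] using (h.tendsto_length v).const_mul (1 - B)
  obtain ⟨n, hn, hlt⟩ := ((hradius.eventually hball).and
    (hsum.eventually_lt_atBot (Real.log c + d * Real.log (1 - B)))).exists
  have hlen := h.length_pos v n
  have hmass := moranMass_pos hp v n
  have hle : c * ((1 - B) * moranLength a b v n) ^ d ≤ moranMass p v n :=
    (ENNReal.ofReal_le_ofReal_iff hmass.le).1 (hn.trans (h.measure_ball_le_mass fun i hi =>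
      mul_le_mul_of_nonneg_left (h.antitone_length v hi.le) hgap.le))
  have hlog := Real.log_le_log (by positivity) hle
  rw [Real.log_mul hc.ne' (by positivity), Real.log_rpow (by positivity),
    Real.log_mul hgap.ne' hlen.ne'] at hlog
  rw [hv n] at hlt
  linarith

end IsMoranRatios

/-! ### Block sums of i.i.d. random variables -/

section BlockSums

variable {Ω : Type*} [MeasurableSpace Ω] {P : Measure Ω}

theorem exists_neg_mgf_lt_one [IsProbabilityMeasure P] {T : Ω → ℝ}
    (hexp : (0 : ℝ) ∈ interior (integrableExpSet T P)) (hpos : 0 < ∫ ω, T ω ∂P) :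
    ∃ s < 0, s ∈ integrableExpSet T P ∧ mgf T P s < 1 := by
  have hderiv : HasDerivAt (mgf T P) (∫ ω, T ω ∂P) 0 := by
    simpa only [zero_mul, Real.exp_zero, mul_one] using hasDerivAt_mgf hexp
  have hslope : ∀ᶠ s in 𝓝[<] (0 : ℝ), 0 < slope (mgf T P) 0 s :=
    ((hasDerivAt_iff_tendsto_slope.1 hderiv).mono_left
      (nhdsWithin_mono 0 fun s hs => ne_of_lt hs)).eventually_const_lt hpos
  have hmem : ∀ᶠ s in 𝓝[<] (0 : ℝ), s ∈ integrableExpSet T P :=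
    mem_nhdsWithin_of_mem_nhds (mem_interior_iff_mem_nhds.1 hexp)
  obtain ⟨s, ⟨hs_slope, hs_mem⟩, hs⟩ := ((hslope.and hmem).and self_mem_nhdsWithin).exists
  have hs : s < 0 := hs
  refine ⟨s, hs, hs_mem, sub_neg.1 ?_⟩
  rw [slope_def_field, mgf_zero, sub_zero] at hs_slope
  exact ((div_pos_iff.1 hs_slope).resolve_left fun hcon => hs.not_gt hcon.2).1

theorem measureReal_sum_nonpos_le_mgf_pow {ι : Type*} {T : ι → Ω → ℝ} {i₀ : ι}
    (hindep : iIndepFun T P) (hident : ∀ i, IdentDistrib (T i) (T i₀) P P) {s : ℝ} (hs : s ≤ 0)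
    (hint : s ∈ integrableExpSet (T i₀) P) (I : Finset ι) :
    P.real {ω | ∑ i ∈ I, T i ω ≤ 0} ≤ mgf (T i₀) P s ^ I.card := by
  have : IsProbabilityMeasure P := hindep.isProbabilityMeasure
  have hmgf : mgf (∑ i ∈ I, T i) P s = mgf (T i₀) P s ^ I.card := by
    rw [hindep.mgf_sum₀ fun i => (hident i).aemeasurable_fst]
    exact Finset.prod_eq_pow_card fun i _ => mgf_congr_of_identDistrib (T i) (T i₀) (hident i) s
  have hint_sum : Integrable (fun ω => Real.exp (s * (∑ i ∈ I, T i) ω)) P :=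
    mgf_pos_iff.1 (hmgf ▸ pow_pos (mgf_pos hint) I.card)
  simpa only [Finset.sum_apply, mul_zero, Real.exp_zero, one_mul, hmgf] using
    measure_le_le_exp_mul_mgf 0 hs hint_sum

theorem exists_ae_eventually_notMem_of_measureReal_le_pow [IsFiniteMeasure P]
    {E : ℕ → ℕ → Set Ω} {ρ : ℝ} (hρ : 0 ≤ ρ) (hρ_lt : ρ < 1)
    (hE : ∀ m k, P.real (E m k) ≤ ρ ^ k) :
    ∃ L : ℝ, 1 < L ∧ ∀ᵐ ω ∂P, ∀ᶠ k : ℕ in atTop, ∀ m : ℕ, (m : ℝ) ≤ L ^ k → ω ∉ E m k := by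
  obtain ⟨L, hL, hLρ⟩ : ∃ L : ℝ, 1 < L ∧ L * ρ < 1 := by
    refine ⟨2 / (1 + ρ), (one_lt_div (by positivity)).2 (by linarith), ?_⟩
    rw [div_mul_eq_mul_div, div_lt_one (by positivity)]
    linarith
  refine ⟨L, hL, ?_⟩
  let F : ℕ → Set Ω := fun k => ⋃ m ∈ Finset.range (⌊L ^ k⌋₊ + 1), E m k
  have hF : ∀ k, P (F k) ≤ ENNReal.ofReal ((L * ρ) ^ k + ρ ^ k) := by
    intro k
    rw [← ofReal_measureReal (measure_ne_top P _)]
    refine ENNReal.ofReal_le_ofReal ?_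
    calc P.real (F k) ≤ ∑ m ∈ Finset.range (⌊L ^ k⌋₊ + 1), P.real (E m k) :=
          measureReal_biUnion_finset_le _ _
      _ ≤ ∑ _m ∈ Finset.range (⌊L ^ k⌋₊ + 1), ρ ^ k := Finset.sum_le_sum fun m _ => hE m k
      _ = (⌊L ^ k⌋₊ + 1) * ρ ^ k := by
          rw [Finset.sum_const, Finset.card_range, nsmul_eq_mul, Nat.cast_add, Nat.cast_one]
      _ ≤ (L ^ k + 1) * ρ ^ k := by gcongr; exact Nat.floor_le (by positivity)
      _ = (L * ρ) ^ k + ρ ^ k := by ring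
  have hsum : Summable fun k : ℕ => (L * ρ) ^ k + ρ ^ k :=
    (summable_geometric_of_lt_one (by positivity) hLρ).add (summable_geometric_of_lt_one hρ hρ_lt)
  have hfin : ∑' k, P (F k) ≠ ⊤ :=
    ne_top_of_le_ne_top hsum.tsum_ofReal_ne_top (ENNReal.tsum_le_tsum hF)
  filter_upwards [ae_eventually_notMem hfin] with ω hω
  filter_upwards [hω] with k hk m hm hmem
  exact hk (Set.mem_biUnion (Finset.mem_coe.2 (Finset.mem_range.2
    (Nat.lt_succ_of_le (Nat.le_floor hm)))) hmem)

theorem exists_ae_eventually_sum_Ico_nonneg {T : ℕ → Ω → ℝ} (hindep : iIndepFun T P)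
    (hident : ∀ n, IdentDistrib (T n) (T 0) P P)
    (hexp : (0 : ℝ) ∈ interior (integrableExpSet (T 0) P)) (hpos : 0 < ∫ ω, T 0 ω ∂P) :
    ∃ L : ℝ, 1 < L ∧ ∀ᵐ ω ∂P, ∀ᶠ k : ℕ in atTop, ∀ m : ℕ, (m : ℝ) ≤ L ^ k →
      0 ≤ ∑ i ∈ Finset.Ico m (m + k), T i ω := by
  have : IsProbabilityMeasure P := hindep.isProbabilityMeasure
  obtain ⟨s, hs, hint, hlt⟩ := exists_neg_mgf_lt_one hexp hpos
  obtain ⟨L, hL, hae⟩ := exists_ae_eventually_notMem_of_measureReal_le_pow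
    (E := fun m k => {ω | ∑ i ∈ Finset.Ico m (m + k), T i ω ≤ 0}) mgf_nonneg hlt fun m k => by
      simpa only [Nat.card_Ico, Nat.add_sub_cancel_left] using
        measureReal_sum_nonpos_le_mgf_pow hindep hident hs.le hint (Finset.Ico m (m + k))
  refine ⟨L, hL, hae.mono fun ω hω => hω.mono fun k hk m hm => ?_⟩
  exact (not_le.1 (hk m hm)).le

theorem ae_tendsto_sum_range_atBot {T : ℕ → Ω → ℝ} (hindep : iIndepFun T P)
    (hident : ∀ n, IdentDistrib (T n) (T 0) P P) (hint : Integrable (T 0) P)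
    (hneg : ∫ ω, T 0 ω ∂P < 0) :
    ∀ᵐ ω ∂P, Tendsto (fun n : ℕ => ∑ i ∈ Finset.range n, T i ω) atTop atBot := by
  filter_upwards [strong_law_ae_real T hint (fun i j hij => hindep.indepFun hij) hident] with ω hω
  refine (hω.neg_mul_atTop hneg tendsto_natCast_atTop_atTop).congr' ?_
  filter_upwards [eventually_ne_atTop 0] with n hn
  exact div_mul_cancel₀ _ (Nat.cast_ne_zero.2 hn)

end BlockSums

/-! ### Exponential moments -/

section ExponentialMoments

variable {Ω : Type*} [MeasurableSpace Ω] {P : Measure Ω}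

theorem ae_pos_of_lintegral_rpow_neg_lt_top {f : Ω → ℝ} (hf : AEMeasurable f P) {t : ℝ}
    (ht : 0 < t) (hmoment : ∫⁻ ω, ENNReal.ofReal (f ω) ^ (-t) ∂P < ⊤) : ∀ᵐ ω ∂P, 0 < f ω := by
  filter_upwards [ae_lt_top' (by fun_prop) hmoment.ne] with ω hω
  refine not_le.1 fun hf_nonpos => hω.ne ?_
  rw [ENNReal.ofReal_of_nonpos hf_nonpos, ENNReal.zero_rpow_of_neg (neg_lt_zero.2 ht)]

theorem zero_mem_interior_integrableExpSet_log [IsFiniteMeasure P] {f : Ω → ℝ}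
    (hf : AEMeasurable f P) (hf_le : ∀ᵐ ω ∂P, f ω ≤ 1) {t : ℝ} (ht : 0 < t)
    (hmoment : ∫⁻ ω, ENNReal.ofReal (f ω) ^ (-t) ∂P < ⊤) :
    (0 : ℝ) ∈ interior (integrableExpSet (fun ω => Real.log (f ω)) P) := by
  have hf_pos := ae_pos_of_lintegral_rpow_neg_lt_top hf ht hmoment
  have hmeas : ∀ s : ℝ, AEStronglyMeasurable (fun ω => Real.exp (s * Real.log (f ω))) P :=
    fun s => (hf.log.const_mul s).exp.aestronglyMeasurable
  have hneg : -t ∈ integrableExpSet (fun ω => Real.log (f ω)) P := by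
    refine ⟨hmeas _, ?_⟩
    rw [hasFiniteIntegral_iff_ofReal (ae_of_all _ fun ω => (Real.exp_pos _).le)]
    refine (lintegral_congr_ae ?_).trans_lt hmoment
    filter_upwards [hf_pos] with ω hω
    rw [ENNReal.ofReal_rpow_of_pos hω, Real.rpow_def_of_pos hω, mul_comm]
  have hpos : t ∈ integrableExpSet (fun ω => Real.log (f ω)) P := by
    refine .of_mem_Icc 0 1 (hmeas t).aemeasurable ?_
    filter_upwards [hf_pos, hf_le] with ω hω hω_le
    exact ⟨(Real.exp_pos _).le, Real.exp_le_one_iff.2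
      (mul_nonpos_of_nonneg_of_nonpos ht.le (Real.log_nonpos hω.le hω_le))⟩
  exact mem_interior_iff_mem_nhds.2 (mem_of_superset (Icc_mem_nhds (neg_lt_zero.2 ht) ht)
    (convex_integrableExpSet.ordConnected.out hneg hpos))

theorem integrableExpSet_subset_sub {T W : Ω → ℝ} (hW : AEMeasurable W P) {C : ℝ}
    (hWC : ∀ᵐ ω ∂P, |W ω| ≤ C) :
    integrableExpSet T P ⊆ integrableExpSet (fun ω => T ω - W ω) P := by
  intro s hs
  have hbound : ∀ᵐ ω ∂P, ‖Real.exp (-s * W ω)‖ ≤ Real.exp (|s| * C) := by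
    filter_upwards [hWC] with ω hω
    rw [Real.norm_eq_abs, Real.abs_exp, Real.exp_le_exp]
    calc -s * W ω ≤ |-s * W ω| := le_abs_self _
      _ = |s| * |W ω| := by rw [abs_mul, abs_neg]
      _ ≤ |s| * C := by gcongr
  refine (Integrable.bdd_mul hs (hW.const_mul (-s)).exp.aestronglyMeasurable hbound).congr
    (ae_of_all _ fun ω => ?_)
  beta_reduce
  rw [← Real.exp_add]
  ring_nf

theorem zero_mem_interior_integrableExpSet_min {T U : Ω → ℝ}
    (hT : (0 : ℝ) ∈ interior (integrableExpSet T P))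
    (hU : (0 : ℝ) ∈ interior (integrableExpSet U P)) :
    (0 : ℝ) ∈ interior (integrableExpSet (fun ω => min (T ω) (U ω)) P) := by
  have hmeas : AEMeasurable (fun ω => min (T ω) (U ω)) P :=
    (aemeasurable_of_mem_interior_integrableExpSet hT).min
      (aemeasurable_of_mem_interior_integrableExpSet hU)
  rw [mem_interior_iff_mem_nhds] at hT hU ⊢
  filter_upwards [hT, hU] with s hsT hsU
  refine (Integrable.add hsT hsU).mono' (hmeas.const_mul s).exp.aestronglyMeasurable
    (ae_of_all _ fun ω => ?_)
  rw [Real.norm_eq_abs, Real.abs_exp, Pi.add_apply]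
  beta_reduce
  rcases min_choice (T ω) (U ω) with hmin | hmin <;> rw [hmin]
  exacts [le_add_of_nonneg_right (Real.exp_pos _).le, le_add_of_nonneg_left (Real.exp_pos _).le]

end ExponentialMoments

/-! ### The mean excess -/

theorem le_moranThreshold_iff {a b p θ : ℝ} (ha : 0 < a) (hb : 0 < b) (hp : p ∈ Set.Ioo 0 1) :
    p ≤ moranThreshold a b θ ↔
      Real.log p - θ * Real.log a ≤ Real.log (1 - p) - θ * Real.log b := by
  have haθ : 0 < a ^ θ := Real.rpow_pos_of_pos ha θ
  have hbθ : 0 < b ^ θ := Real.rpow_pos_of_pos hb θ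
  have hp' : 0 < 1 - p := sub_pos.2 hp.2
  calc p ≤ moranThreshold a b θ ↔ p * b ^ θ ≤ (1 - p) * a ^ θ := by
        rw [moranThreshold, le_div_iff₀ (add_pos haθ hbθ), mul_add, sub_mul, one_mul,
          le_sub_iff_add_le, add_comm]
    _ ↔ Real.log p + θ * Real.log b ≤ Real.log (1 - p) + θ * Real.log a := by
        rw [← Real.log_le_log_iff (mul_pos hp.1 hbθ) (mul_pos hp' haθ),
          Real.log_mul hp.1.ne' hbθ.ne', Real.log_mul hp'.ne' haθ.ne', Real.log_rpow ha,
          Real.log_rpow hb]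
    _ ↔ _ := by rw [sub_le_sub_iff]

theorem moranY_sub_mul_moranZ {a b p : ℝ} (ha : 0 < a) (hb : 0 < b) (hp : p ∈ Set.Ioo 0 1)
    (θ : ℝ) : moranY a b p θ - θ * moranZ a b p θ = moranExcess a b p θ := by
  rw [moranExcess, min_def, moranY, moranZ]
  simp only [le_moranThreshold_iff ha hb hp]
  split_ifs <;> rfl

theorem measurable_moranExcess (θ : ℝ) :
    Measurable fun x : ℝ × ℝ × unitInterval => moranExcess x.1 x.2.1 x.2.2 θ := by
  unfold moranExcess
  fun_prop

theorem measurable_moranZ (θ : ℝ) :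
    Measurable fun x : ℝ × ℝ × unitInterval => moranZ x.1 x.2.1 x.2.2 θ := by
  unfold moranZ moranThreshold
  refine Measurable.ite (measurableSet_le ?_ ?_) ?_ ?_ <;> fun_prop

theorem moranExcess_add_le {a b B θ θ' : ℝ} (ha : 0 < a) (hb : 0 < b) (haB : a ≤ B) (hbB : b ≤ B)
    (p : ℝ) (hθ : θ ≤ θ') :
    moranExcess a b p θ + (θ' - θ) * -Real.log B ≤ moranExcess a b p θ' := by
  rw [moranExcess, moranExcess, ← min_add_add_right]
  have hθ := sub_nonneg.2 hθ
  refine min_le_min ?_ ?_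
  · linarith [mul_le_mul_of_nonneg_left (Real.log_le_log ha haB) hθ]
  · linarith [mul_le_mul_of_nonneg_left (Real.log_le_log hb hbB) hθ]

theorem moranExcess_le_add {a b A θ θ' : ℝ} (hA : 0 < A) (ha : A ≤ a) (hb : A ≤ b) (p : ℝ)
    (hθ : θ ≤ θ') :
    moranExcess a b p θ' ≤ moranExcess a b p θ + (θ' - θ) * -Real.log A := by
  rw [moranExcess, moranExcess, ← min_add_add_right]
  have hθ := sub_nonneg.2 hθ
  refine min_le_min ?_ ?_
  · linarith [mul_le_mul_of_nonneg_left (Real.log_le_log hA ha) hθ]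
  · linarith [mul_le_mul_of_nonneg_left (Real.log_le_log hA hb) hθ]

/-- The mean of `moranExcess` for random ratios `a`, `b` and a random weight `p`. Its sign at `θ`
decides whether `moranG` lies below the diagonal at `θ`. -/
noncomputable def moranMeanExcess {Ω : Type*} [MeasurableSpace Ω] (P : Measure Ω)
    (a b : Ω → ℝ) (p : Ω → unitInterval) (θ : ℝ) : ℝ :=
  ∫ ω, moranExcess (a ω) (b ω) (p ω) θ ∂P

theorem moranMeanExcess_zero_nonpos {Ω : Type*} [MeasurableSpace Ω] (P : Measure Ω) (a b : Ω → ℝ)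
    (p : Ω → unitInterval) : moranMeanExcess P a b p 0 ≤ 0 := by
  refine integral_nonpos fun ω => (min_le_left _ _).trans ?_
  rw [zero_mul, sub_zero]
  exact Real.log_nonpos (p ω).2.1 (p ω).2.2

/-- One random step of the construction: almost surely the ratios `a`, `b` are admissible and the
weights `p`, `1 - p` are positive, and the logarithms of the weights have exponential moments, which
is how negative moments of the weights are encoded. -/
structure IsRandomMoranStep {Ω : Type*} [MeasurableSpace Ω] (P : Measure Ω) (A B : ℝ)
    (a b : Ω → ℝ) (p : Ω → unitInterval) : Prop where
  pos : 0 < A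
  lt_one : B < 1
  aemeasurable : AEMeasurable (fun ω => (a ω, b ω, p ω)) P
  ratio : ∀ᵐ ω ∂P, A ≤ a ω ∧ A ≤ b ω ∧ a ω + b ω ≤ B
  weight : ∀ᵐ ω ∂P, (p ω : ℝ) ∈ Set.Ioo 0 1
  exp_left : (0 : ℝ) ∈ interior (integrableExpSet (fun ω => Real.log (p ω)) P)
  exp_right : (0 : ℝ) ∈ interior (integrableExpSet (fun ω => Real.log (1 - p ω)) P)

namespace IsRandomMoranStep

theorem of_moments {Ω : Type*} [MeasurableSpace Ω] {P : Measure Ω}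
    [IsFiniteMeasure P] {A B : ℝ} (hA : 0 < A) (hB : B < 1) {a b : Ω → ℝ} {p : Ω → unitInterval}
    (hmeas : AEMeasurable (fun ω => (a ω, b ω, p ω)) P)
    (hab : ∀ᵐ ω ∂P, A ≤ min (a ω) (b ω) ∧ a ω + b ω ≤ B)
    (hmoment : ∃ t : ℝ, 0 < t ∧ ∫⁻ ω, ENNReal.ofReal (p ω : ℝ) ^ (-t) ∂P < ⊤)
    (hmoment' : ∃ t : ℝ, 0 < t ∧ ∫⁻ ω, ENNReal.ofReal (1 - (p ω : ℝ)) ^ (-t) ∂P < ⊤) :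
    IsRandomMoranStep P A B a b p := by
  obtain ⟨t, ht, hpt⟩ := hmoment
  obtain ⟨t', ht', hpt'⟩ := hmoment'
  have hp : AEMeasurable (fun ω => (p ω : ℝ)) P :=
    (by fun_prop : Measurable fun x : ℝ × ℝ × unitInterval => (x.2.2 : ℝ)).comp_aemeasurable hmeas
  have hp' : AEMeasurable (fun ω => 1 - (p ω : ℝ)) P := hp.const_sub 1
  exact {
    pos := hA
    lt_one := hB
    aemeasurable := hmeas
    ratio := hab.mono fun ω hω => ⟨(le_min_iff.1 hω.1).1, (le_min_iff.1 hω.1).2, hω.2⟩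
    weight := by
      filter_upwards [ae_pos_of_lintegral_rpow_neg_lt_top hp ht hpt,
        ae_pos_of_lintegral_rpow_neg_lt_top hp' ht' hpt'] with ω hpos hlt
      exact ⟨hpos, sub_pos.1 hlt⟩
    exp_left := zero_mem_interior_integrableExpSet_log hp (ae_of_all _ fun ω => (p ω).2.2) ht hpt
    exp_right := zero_mem_interior_integrableExpSet_log hp'
      (ae_of_all _ fun ω => sub_le_self 1 (p ω).2.1) ht' hpt' }

variable {Ω : Type*} [MeasurableSpace Ω] {P : Measure Ω} {A B : ℝ} {a b : Ω → ℝ}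
  {p : Ω → unitInterval} (h : IsRandomMoranStep P A B a b p)
include h

theorem ae_mem_Icc : ∀ᵐ ω ∂P, a ω ∈ Set.Icc A B ∧ b ω ∈ Set.Icc A B := by
  filter_upwards [h.ratio] with ω ⟨ha, hb, hab⟩
  have hA := h.pos
  exact ⟨⟨ha, by linarith⟩, hb, by linarith⟩

theorem log_upper_neg [NeZero P] : Real.log B < 0 := by
  obtain ⟨ω, ⟨ha, haB⟩, -⟩ := h.ae_mem_Icc.exists
  exact Real.log_neg (h.pos.trans_le (ha.trans haB)) h.lt_one

theorem ae_moranZ_mem_Icc (θ : ℝ) :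
    ∀ᵐ ω ∂P, moranZ (a ω) (b ω) (p ω) θ ∈ Set.Icc (Real.log A) (Real.log B) := by
  have hlog : ∀ x ∈ Set.Icc A B, Real.log x ∈ Set.Icc (Real.log A) (Real.log B) := fun x hx =>
    ⟨Real.log_le_log h.pos hx.1, Real.log_le_log (h.pos.trans_le hx.1) hx.2⟩
  filter_upwards [h.ae_mem_Icc] with ω hω
  unfold moranZ
  split_ifs
  exacts [hlog _ hω.1, hlog _ hω.2]

theorem ae_moranY_sub_mul_moranZ (θ : ℝ) :
    ∀ᵐ ω ∂P, moranY (a ω) (b ω) (p ω) θ - θ * moranZ (a ω) (b ω) (p ω) θ =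
      moranExcess (a ω) (b ω) (p ω) θ := by
  filter_upwards [h.ratio, h.weight] with ω ⟨ha, hb, _⟩ hp
  exact moranY_sub_mul_moranZ (h.pos.trans_le ha) (h.pos.trans_le hb) hp θ

theorem zero_mem_interior_integrableExpSet_moranExcess (θ : ℝ) :
    (0 : ℝ) ∈ interior (integrableExpSet (fun ω => moranExcess (a ω) (b ω) (p ω) θ) P) := by
  have hbound : ∀ {x : ℝ}, x ∈ Set.Icc A B → |θ * Real.log x| ≤ |θ| * -Real.log A := by
    intro x hx
    have hx_pos := h.pos.trans_le hx.1
    rw [abs_mul, abs_of_nonpos (Real.log_nonpos hx_pos.le (hx.2.trans h.lt_one.le))]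
    gcongr
    exacts [h.pos, hx.1]
  have ha : AEMeasurable a P := measurable_fst.comp_aemeasurable h.aemeasurable
  have hb : AEMeasurable b P :=
    (measurable_fst.comp measurable_snd).comp_aemeasurable h.aemeasurable
  exact zero_mem_interior_integrableExpSet_min
    (interior_mono (integrableExpSet_subset_sub (ha.log.const_mul θ)
      (h.ae_mem_Icc.mono fun ω hω => hbound hω.1)) h.exp_left)
    (interior_mono (integrableExpSet_subset_sub (hb.log.const_mul θ)
      (h.ae_mem_Icc.mono fun ω hω => hbound hω.2)) h.exp_right)

theorem integrable_moranExcess (θ : ℝ) :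
    Integrable (fun ω => moranExcess (a ω) (b ω) (p ω) θ) P :=
  integrable_of_mem_interior_integrableExpSet (h.zero_mem_interior_integrableExpSet_moranExcess θ)

variable [IsProbabilityMeasure P]

theorem integrable_moranZ (θ : ℝ) : Integrable (fun ω => moranZ (a ω) (b ω) (p ω) θ) P :=
  .of_mem_Icc _ _ ((measurable_moranZ θ).comp_aemeasurable h.aemeasurable) (h.ae_moranZ_mem_Icc θ)

theorem integral_moranZ_neg (θ : ℝ) : ∫ ω, moranZ (a ω) (b ω) (p ω) θ ∂P < 0 := by
  refine lt_of_le_of_lt ?_ h.log_upper_neg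
  simpa only [integral_const, probReal_univ, one_smul] using integral_mono_ae
    (h.integrable_moranZ θ) (integrable_const (Real.log B))
    ((h.ae_moranZ_mem_Icc θ).mono fun ω hω => hω.2)

theorem integral_moranY (θ : ℝ) :
    ∫ ω, moranY (a ω) (b ω) (p ω) θ ∂P =
      moranMeanExcess P a b p θ + θ * ∫ ω, moranZ (a ω) (b ω) (p ω) θ ∂P := by
  rw [moranMeanExcess, ← integral_const_mul,
    ← integral_add (h.integrable_moranExcess θ) ((h.integrable_moranZ θ).const_mul θ)]
  refine integral_congr_ae ((h.ae_moranY_sub_mul_moranZ θ).mono fun ω hω => ?_)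
  exact sub_eq_iff_eq_add.1 hω

theorem moranG_lt_iff (θ : ℝ) : moranG P a b p θ < θ ↔ 0 < moranMeanExcess P a b p θ := by
  rw [moranG, div_lt_iff_of_neg (h.integral_moranZ_neg θ), h.integral_moranY, lt_add_iff_pos_left]

theorem moranMeanExcess_add_le {θ θ' : ℝ} (hθ : θ ≤ θ') :
    moranMeanExcess P a b p θ + (θ' - θ) * -Real.log B ≤ moranMeanExcess P a b p θ' := by
  have hle := integral_mono_ae ((h.integrable_moranExcess θ).add
    (integrable_const ((θ' - θ) * -Real.log B))) (h.integrable_moranExcess θ') <| by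
      filter_upwards [h.ae_mem_Icc] with ω ⟨ha, hb⟩
      exact moranExcess_add_le (h.pos.trans_le ha.1) (h.pos.trans_le hb.1) ha.2 hb.2 (p ω) hθ
  simpa only [moranMeanExcess, Pi.add_apply, integral_add (h.integrable_moranExcess θ)
    (integrable_const _), integral_const, probReal_univ, one_smul] using hle

theorem moranMeanExcess_le_add {θ θ' : ℝ} (hθ : θ ≤ θ') :
    moranMeanExcess P a b p θ' ≤ moranMeanExcess P a b p θ + (θ' - θ) * -Real.log A := by
  have hle := integral_mono_ae (h.integrable_moranExcess θ') ((h.integrable_moranExcess θ).add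
    (integrable_const ((θ' - θ) * -Real.log A))) <| by
      filter_upwards [h.ratio] with ω ⟨ha, hb, _⟩
      exact moranExcess_le_add h.pos ha hb (p ω) hθ
  simpa only [moranMeanExcess, Pi.add_apply, integral_add (h.integrable_moranExcess θ)
    (integrable_const _), integral_const, probReal_univ, one_smul] using hle

theorem strictMono_moranMeanExcess : StrictMono (moranMeanExcess P a b p) := by
  intro θ θ' hθ
  have hgain := mul_pos (sub_pos.2 hθ) (neg_pos.2 h.log_upper_neg)
  exact (lt_add_of_pos_right _ hgain).trans_le (h.moranMeanExcess_add_le hθ.le)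

theorem continuous_moranMeanExcess : Continuous (moranMeanExcess P a b p) := by
  refine (LipschitzWith.of_le_add_mul (-Real.log A).toNNReal fun θ θ' => ?_).continuous
  rcases le_total θ θ' with hθ | hθ
  · exact (h.strictMono_moranMeanExcess.monotone hθ).trans (le_add_of_nonneg_right (by positivity))
  · refine (h.moranMeanExcess_le_add hθ).trans ?_
    rw [Real.dist_eq, abs_of_nonneg (sub_nonneg.2 hθ), mul_comm]
    gcongr
    exact Real.le_coe_toNNReal _

theorem exists_moranMeanExcess_eq_zero : ∃ α : ℝ, 0 ≤ α ∧ moranMeanExcess P a b p α = 0 := by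
  have hB := h.log_upper_neg
  have hF := moranMeanExcess_zero_nonpos P a b p
  set θ := moranMeanExcess P a b p 0 / Real.log B
  have hθ : 0 ≤ θ := div_nonneg_of_nonpos hF hB.le
  have hFθ : 0 ≤ moranMeanExcess P a b p θ := by
    have hθB : θ * Real.log B = moranMeanExcess P a b p 0 := div_mul_cancel₀ _ hB.ne
    linarith [h.moranMeanExcess_add_le hθ]
  obtain ⟨α, hα, hα_zero⟩ := intermediate_value_Icc hθ h.continuous_moranMeanExcess.continuousOn
    (Set.mem_Icc.2 ⟨hF, hFθ⟩)
  exact ⟨α, hα.1, hα_zero⟩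

end IsRandomMoranStep

theorem crossesDiagonalAt_iff_eq {G : ℝ → ℝ} {α β : ℝ} (hα : 0 ≤ α)
    (hG : ∀ θ, 0 ≤ θ → (G θ < θ ↔ α < θ)) : CrossesDiagonalAt G β ↔ β = α := by
  constructor
  · rintro ⟨hbelow, habove⟩
    apply le_antisymm
    · refine not_lt.1 fun hαβ => ?_
      obtain ⟨ψ, hαψ, hψβ⟩ := exists_between hαβ
      have hψ := hα.trans hαψ.le
      exact (habove ψ hψ hψβ).not_gt ((hG ψ hψ).2 hαψ)
    · exact not_lt.1 fun hβα => lt_irrefl α ((hG α hα).1 (hbelow α hα hβα))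
  · rintro rfl
    exact ⟨fun ψ hψ hlt => (hG ψ hψ).2 hlt,
      fun ψ hψ hlt => not_lt.1 fun hcon => hlt.asymm ((hG ψ hψ).1 hcon)⟩

/-! ### The almost sure dimension -/

/-- The random data of the construction: the triples of ratios and weight of the successive steps
are independent and all distributed as the triple of the first step. -/
structure IsMoranProcess {Ω : Type*} [MeasurableSpace Ω] (P : Measure Ω) (A B : ℝ)
    (a b : ℕ → Ω → ℝ) (p : ℕ → Ω → unitInterval) : Prop where
  step : IsRandomMoranStep P A B (a 0) (b 0) (p 0)
  indep : iIndepFun (fun n ω => (a n ω, b n ω, p n ω)) P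
  ident : ∀ n, IdentDistrib (fun ω => (a n ω, b n ω, p n ω)) (fun ω => (a 0 ω, b 0 ω, p 0 ω)) P P

namespace IsMoranProcess

variable {Ω : Type*} [MeasurableSpace Ω] {P : Measure Ω} {A B : ℝ} {a b : ℕ → Ω → ℝ}
  {p : ℕ → Ω → unitInterval} (h : IsMoranProcess P A B a b p)
include h

theorem ae_isMoranRatios : ∀ᵐ ω ∂P, IsMoranRatios A B (fun n => a n ω) fun n => b n ω := by
  have hset : MeasurableSet {x : ℝ × ℝ × unitInterval | A ≤ x.1 ∧ A ≤ x.2.1 ∧ x.1 + x.2.1 ≤ B} := by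
    measurability
  have hall : ∀ᵐ ω ∂P, ∀ n, A ≤ a n ω ∧ A ≤ b n ω ∧ a n ω + b n ω ≤ B :=
    ae_all_iff.2 fun n => (h.ident n).symm.ae_snd hset h.step.ratio
  filter_upwards [hall] with ω hω
  exact ⟨h.step.pos, h.step.lt_one, fun n => (hω n).1, fun n => (hω n).2.1, fun n => (hω n).2.2⟩

theorem ae_weight_mem_Ioo : ∀ᵐ ω ∂P, ∀ n, (p n ω : ℝ) ∈ Set.Ioo 0 1 := by
  have hmeas : Measurable fun x : ℝ × ℝ × unitInterval => (x.2.2 : ℝ) := by fun_prop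
  exact ae_all_iff.2 fun n => (h.ident n).symm.ae_snd
    (p := fun x => (x.2.2 : ℝ) ∈ Set.Ioo 0 1) (hmeas measurableSet_Ioo) h.step.weight

theorem iIndepFun_moranExcess (θ : ℝ) :
    iIndepFun (fun n ω => moranExcess (a n ω) (b n ω) (p n ω) θ) P :=
  h.indep.comp (fun _ x => moranExcess x.1 x.2.1 x.2.2 θ) fun _ => measurable_moranExcess θ

theorem identDistrib_moranExcess (θ : ℝ) (n : ℕ) :
    IdentDistrib (fun ω => moranExcess (a n ω) (b n ω) (p n ω) θ)
      (fun ω => moranExcess (a 0 ω) (b 0 ω) (p 0 ω) θ) P P :=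
  (h.ident n).comp (measurable_moranExcess θ)

theorem ae_mem_upperPhiExponents {Φ : ℝ → ℝ} (hΦ : IsLargeDimensionFunction Φ) {d : ℝ}
    (hd : 0 ≤ d) (hpos : 0 < moranMeanExcess P (a 0) (b 0) (p 0) d) :
    ∀ᵐ ω ∂P, d ∈ upperPhiExponents Φ
      (moranMeasure (fun n => a n ω) (fun n => b n ω) (fun n => p n ω)) := by
  obtain ⟨L, hL, hsum⟩ := exists_ae_eventually_sum_Ico_nonneg (h.iIndepFun_moranExcess d)
    (h.identDistrib_moranExcess d) (h.step.zero_mem_interior_integrableExpSet_moranExcess d) hpos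
  filter_upwards [h.ae_isMoranRatios, h.ae_weight_mem_Ioo, hsum] with ω hratio hweight hsum_ω
  exact hratio.mem_upperPhiExponents hweight hΦ hd hL hsum_ω

theorem ae_notMem_upperPhiExponents {Φ : ℝ → ℝ} (hΦ : ∀ t ∈ Set.Ioo (0 : ℝ) 1, 0 ≤ Φ t) {d : ℝ}
    (hneg : moranMeanExcess P (a 0) (b 0) (p 0) d < 0) :
    ∀ᵐ ω ∂P, d ∉ upperPhiExponents Φ
      (moranMeasure (fun n => a n ω) (fun n => b n ω) (fun n => p n ω)) := by
  have hsum := ae_tendsto_sum_range_atBot (h.iIndepFun_moranExcess d)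
    (h.identDistrib_moranExcess d) (h.step.integrable_moranExcess d) hneg
  filter_upwards [h.ae_isMoranRatios, h.ae_weight_mem_Ioo, hsum] with ω hratio hweight hsum_ω
  exact hratio.notMem_upperPhiExponents hweight hΦ hsum_ω

theorem ae_upperPhiDim_eq {Φ : ℝ → ℝ} (hΦ : IsLargeDimensionFunction Φ) {α : ℝ} (hα : 0 ≤ α)
    (hzero : moranMeanExcess P (a 0) (b 0) (p 0) α = 0) :
    ∀ᵐ ω ∂P, upperPhiDim Φ
      (moranMeasure (fun n => a n ω) (fun n => b n ω) (fun n => p n ω)) = (α : EReal) := by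
  have : IsProbabilityMeasure P := h.indep.isProbabilityMeasure
  have hmono := h.step.strictMono_moranMeanExcess
  have hlower : ∀ᵐ ω ∂P, ∀ q : ℚ, (q : ℝ) < α → (q : ℝ) ∉ upperPhiExponents Φ
      (moranMeasure (fun n => a n ω) (fun n => b n ω) (fun n => p n ω)) :=
    ae_all_iff.2 fun q => eventually_imp_distrib_left.2 fun hq =>
      h.ae_notMem_upperPhiExponents hΦ.1.nonneg ((hmono hq).trans_eq hzero)
  have hupper : ∀ᵐ ω ∂P, ∀ q : ℚ, α < (q : ℝ) → (q : ℝ) ∈ upperPhiExponents Φ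
      (moranMeasure (fun n => a n ω) (fun n => b n ω) (fun n => p n ω)) :=
    ae_all_iff.2 fun q => eventually_imp_distrib_left.2 fun hq =>
      h.ae_mem_upperPhiExponents hΦ (hα.trans hq.le) (hzero.symm.trans_lt (hmono hq))
  filter_upwards [hlower, hupper] with ω hω_lower hω_upper
  exact upperPhiDim_eq_of_forall_rat hω_lower hω_upper

end IsMoranProcess

theorem mainTheorem3_general {Ω : Type*} [MeasurableSpace Ω] (P : Measure Ω)
    (A B : ℝ) (hA : 0 < A) (hB : B < 1) (a b : ℕ → Ω → ℝ) (p : ℕ → Ω → unitInterval)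
    (hab : ∀ᵐ ω ∂P, A ≤ min (a 0 ω) (b 0 ω) ∧ a 0 ω + b 0 ω ≤ B)
    (hindep : iIndepFun (fun n ω => (a n ω, b n ω, p n ω)) P)
    (hident : ∀ n, IdentDistrib (fun ω => (a n ω, b n ω, p n ω))
      (fun ω => (a 0 ω, b 0 ω, p 0 ω)) P P)
    (hmoment : ∃ t : ℝ, 0 < t ∧ ∫⁻ ω, ENNReal.ofReal (p 0 ω : ℝ) ^ (-t) ∂P < ⊤)
    (hmoment' : ∃ t : ℝ, 0 < t ∧ ∫⁻ ω, ENNReal.ofReal (1 - (p 0 ω : ℝ)) ^ (-t) ∂P < ⊤)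
    (Φ : ℝ → ℝ) (hΦ : IsLargeDimensionFunction Φ) :
    (∀ α : ℝ,
      (∀ᵐ ω ∂P, upperPhiDim Φ
          (moranMeasure (fun n => a n ω) (fun n => b n ω) (fun n => p n ω)) = (α : EReal)) ↔
        CrossesDiagonalAt (moranG P (a 0) (b 0) (p 0)) α) ∧
    ∃ α : ℝ, 0 ≤ α ∧
      (∀ᵐ ω ∂P, upperPhiDim Φ
          (moranMeasure (fun n => a n ω) (fun n => b n ω) (fun n => p n ω)) = (α : EReal)) ∧
      CrossesDiagonalAt (moranG P (a 0) (b 0) (p 0)) α := by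
  have : IsProbabilityMeasure P := hindep.isProbabilityMeasure
  have h : IsMoranProcess P A B a b p :=
    ⟨.of_moments hA hB (hident 0).aemeasurable_fst hab hmoment hmoment', hindep, hident⟩
  obtain ⟨α, hα, hzero⟩ := h.step.exists_moranMeanExcess_eq_zero
  have hdim := h.ae_upperPhiDim_eq hΦ hα hzero
  have hcross : ∀ β, CrossesDiagonalAt (moranG P (a 0) (b 0) (p 0)) β ↔ β = α := fun β =>
    crossesDiagonalAt_iff_eq hα fun θ _ => by
      rw [h.step.moranG_lt_iff, ← hzero, h.step.strictMono_moranMeanExcess.lt_iff_lt]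
  refine ⟨fun β => ⟨fun hβ => (hcross β).2 ?_, fun hβ => ?_⟩, α, hα, hdim, (hcross α).2 rfl⟩
  · obtain ⟨ω, hω_dim, hω⟩ := (hβ.and hdim).exists
    exact EReal.coe_eq_coe_iff.1 (hω_dim.symm.trans hω)
  · rwa [(hcross β).1 hβ]

theorem mainTheorem3 {Ω : Type*} [MeasurableSpace Ω] (P : Measure Ω) [IsProbabilityMeasure P]
    (A B : ℝ) (hA : 0 < A) (hAB : A < B) (hB : B < 1)
    (a b : ℕ → Ω → ℝ) (p : ℕ → Ω → unitInterval)
    (ha : ∀ n, Measurable (a n)) (hb : ∀ n, Measurable (b n)) (hp : ∀ n, Measurable (p n))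
    -- the values of `(a n, b n)` lie in the prescribed set
    (hab : ∀ n ω, A ≤ min (a n ω) (b n ω) ∧ a n ω + b n ω ≤ B)
    -- the triples `(a n, b n, p n)` are independent and identically distributed,
    -- and `p n` is independent of `(a n, b n)`
    (hindep : iIndepFun (fun n ω => (a n ω, b n ω, p n ω)) P)
    (hident : ∀ n, IdentDistrib (fun ω => (a n ω, b n ω, p n ω))
      (fun ω => (a 0 ω, b 0 ω, p 0 ω)) P P)
    (hindep' : ∀ n, IndepFun (fun ω => (a n ω, b n ω)) (p n) P)
    -- `𝔼 p ^ (-t)` and `𝔼 (1 - p) ^ (-t)` are finite for some `t > 0`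
    (hmoment : ∃ t : ℝ, 0 < t ∧ ∫⁻ ω, ENNReal.ofReal (p 0 ω : ℝ) ^ (-t) ∂P < ⊤)
    (hmoment' : ∃ t : ℝ, 0 < t ∧ ∫⁻ ω, ENNReal.ofReal (1 - (p 0 ω : ℝ)) ^ (-t) ∂P < ⊤)
    (Φ : ℝ → ℝ) (hΦ : IsLargeDimensionFunction Φ) :
    (∀ α : ℝ,
      (∀ᵐ ω ∂P, upperPhiDim Φ
          (moranMeasure (fun n => a n ω) (fun n => b n ω) (fun n => p n ω)) = (α : EReal)) ↔
        CrossesDiagonalAt (moranG P (a 0) (b 0) (p 0)) α) ∧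
    ∃ α : ℝ, 0 ≤ α ∧
      (∀ᵐ ω ∂P, upperPhiDim Φ
          (moranMeasure (fun n => a n ω) (fun n => b n ω) (fun n => p n ω)) = (α : EReal)) ∧
      CrossesDiagonalAt (moranG P (a 0) (b 0) (p 0)) α :=
  mainTheorem3_general P A B hA hB a b p (ae_of_all _ (hab 0)) hindep hident hmoment hmoment' Φ hΦ
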